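/- Let $R$ be a commutative ring with unit and let $\mathbf{M}$ be one of the following categories: the category of $R$-modules, the category of $\mathbb{N}_0$-graded $R$-modules with degree-preserving maps, or the category of $\mathbb{N}_0$-graded modules over the graded polynomial ring $R[t]$ ($\deg t=1$) with degree-preserving maps. For a topological space $X$ let $H^k(X,-)=R^k\Gamma(X,-)$ denote the $k$-th right derived functor of the global section functor $\Gamma(X,-)$ from sheaves on $X$ with values in $\mathbf{M}$ to $\mathbf{M}$. For a continuous map $f\colon X\to Y$ let $f^*$ be the inverse image functor ($f^*\mathcal{F}$ is the sheafification of $U\mapsto \operatorname{colim}_{V\supseteq f(U)}\mathcal{F}(V)$), which is left adjoint to the direct image functor $f_*$, with unit $\eta\colon \mathrm{id}\to f_*f^*$. For a sheaf $\mathcal{F}$ on $Y$, the map $$H^k(f,\mathcal{F})\colon H^k(Y,\mathcal{F})\to H^k(X,f^*\mathcal{F})$$ is defined by choosing injective resolutions $\mathcal{I}^\bullet$ of $\mathcal{F}$ and $\mathcal{J}^\bullet$ of $f^*\mathcal{F}$ and a cochain map $g^\bullet\colon f^*\mathcal{I}^\bullet\to\mathcal{J}^\bullet$ lifting the identity of $f^*\mathcal{F}$,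 and applying $H^k$ to the composition $$\Gamma(Y,\mathcal{I}^\bullet)\xrightarrow{\ \Gamma(Y,\eta)\ }\Gamma(Y,f_*f^*\mathcal{I}^\bullet)=\Gamma(X,f^*\mathcal{I}^\bullet)\xrightarrow{\ \Gamma(X,g^\bullet)\ }\Gamma(X,\mathcal{J}^\bullet).$$ (1) Let $f\colon X\to Y$ be continuous and let $\varphi\colon\mathcal{F}\to\mathcal{G}$ be a morphism of sheaves on $Y$ with values in $\mathbf{M}$. Then, for all $k\ge 0$ and for all choices made in the definitions of $H^k(f,\mathcal{F})$ and $H^k(f,\mathcal{G})$, $$H^k(f,\mathcal{G})\circ H^k(Y,\varphi)=H^k(X,f^*\varphi)\circ H^k(f,\mathcal{F}).$$ (2) Let $X_0\to X_1\to X_2\to\cdots\to X_\infty$ be a functor from the ordered set $\mathbb{N}_0\cup\{\infty\}$ to topological spaces, with maps $X_i^{l}\colon X_i\to X_l$, and let $\mathcal{F}_0\to\mathcal{F}_1\to\mathcal{F}_2\to\cdots$ be a sequence of morphisms of sheaves on $X_\infty$ with values in $\mathbf{M}$. Put $\mathcal{F}^i_j=(X_i^\infty)^*\mathcal{F}_j$.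 Then, for every $k\ge 0$, the two-dimensional diagram with objects $H^k(X_i,\mathcal{F}^i_j)$, $i,j\in\mathbb{N}_0$, whose rows are the type A persistence modules $$H^k(X_i,\mathcal{F}^i_0)\to H^k(X_i,\mathcal{F}^i_1)\to H^k(X_i,\mathcal{F}^i_2)\to\cdots$$ induced by the maps $(X_i^\infty)^*(\mathcal{F}_j\to\mathcal{F}_{j+1})$, and whose columns are the type T copersistence modules $$H^k(X_0,\mathcal{F}^0_j)\leftarrow H^k(X_1,\mathcal{F}^1_j)\leftarrow H^k(X_2,\mathcal{F}^2_j)\leftarrow\cdots$$ with maps $H^k(X_i^{i+1},\mathcal{F}^{i+1}_j)$, where $(X_i^{i+1})^*\mathcal{F}^{i+1}_j$ is identified with $\mathcal{F}^i_j$ by the canonical isomorphism, is commutative; that is, it is a functor $\mathbb{N}_0\times\mathbb{N}_0^{\mathrm{op}}\to\mathbf{M}$. -/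

import Mathlib

open CategoryTheory Limits Opposite TopologicalSpace

universe w w' v v' u

namespace SheafCoh

noncomputable section

/-! ### Sheafification with values in categories of diagrams -/

section Sheafification

variable {C : Type u} [SmallCategory C] (J : GrothendieckTopology C)

lemma hasSheafify_of_adjunction {A : Type v} [Category.{w} A] {D : Type v'} [Category.{w'} D]
    (L : (Cᵒᵖ ⥤ A) ⥤ D) [PreservesFiniteLimits L] (G : D ⥤ Sheaf J A) [G.IsEquivalence]
    (adj : L ⊣ G ⋙ sheafToPresheaf J A) : HasSheafify J A :=
  HasSheafify.mk' J A (F := L ⋙ G) ((adj.comp G.asEquivalence.toAdjunction).ofNatIsoRight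
    ((Functor.associator _ _ _).symm ≪≫
      Functor.isoWhiskerRight G.asEquivalence.counitIso _ ≪≫ Functor.leftUnitor _))

lemma hasSheafify_of_equivalence {A : Type v} {B : Type v'} [Category.{u} A] [Category.{u} B]
    (e : A ≌ B) [HasSheafify J B] : HasSheafify J A := by
  let G : Sheaf J B ⥤ Sheaf J A := sheafCompose J e.inverse
  have : G.EssSurj := ⟨fun F => ⟨(sheafCompose J e.functor).obj F,
    ⟨(fullyFaithfulSheafToPresheaf J A).preimageIso
      (Functor.isoWhiskerLeft F.obj e.unitIso.symm)⟩⟩⟩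
  have : G.IsEquivalence := { }
  exact hasSheafify_of_adjunction J
    ((Functor.whiskeringRight Cᵒᵖ A B).obj e.functor ⋙ presheafToSheaf J B) G
    ((e.toAdjunction.whiskerRight Cᵒᵖ).comp (sheafificationAdjunction J B))

lemma isSheaf_functor_iff {K : Type w} [Category.{v'} K] {B : Type v} [Category.{u} B]
    [HasLimitsOfSize.{u, u} B] (P : Cᵒᵖ ⥤ K ⥤ B) :
    Presheaf.IsSheaf J P ↔ ∀ k, Presheaf.IsSheaf J (P ⋙ (evaluation K B).obj k) := by
  constructor
  · intro h k
    exact GrothendieckTopology.HasSheafCompose.isSheaf _ h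
  · intro h
    rw [Presheaf.isSheaf_iff_isLimit]
    intro X S hS
    refine ⟨evaluationJointlyReflectsLimits _ fun k => ?_⟩
    exact ((Presheaf.isSheaf_iff_isLimit J _).1 (h k) S hS).some

lemma hasSheafify_functor (K : Type) [SmallCategory K] (B : Type v) [Category.{u} B]
    [HasLimitsOfSize.{u, u} B] [HasSheafify J B] : HasSheafify J (K ⥤ B) := by
  let R : (K ⥤ Sheaf J B) ⥤ Cᵒᵖ ⥤ K ⥤ B :=
    (Functor.whiskeringRight K _ _).obj (sheafToPresheaf J B) ⋙ flipFunctor K Cᵒᵖ B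
  let hR : R.FullyFaithful :=
    ((fullyFaithfulSheafToPresheaf J B).whiskeringRight K).comp
      (Functor.flipping (C := K) (D := Cᵒᵖ) (E := B)).fullyFaithfulFunctor
  let G : (K ⥤ Sheaf J B) ⥤ Sheaf J (K ⥤ B) := ObjectProperty.lift _ R fun F =>
    (isSheaf_functor_iff J _).2 fun k => (F.obj k).property
  have hG : G.FullyFaithful := Functor.FullyFaithful.ofCompFaithful (G := sheafToPresheaf J _) hR
  have := hG.full
  have := hG.faithful
  have : G.EssSurj := ⟨fun F => ⟨{
      obj k := ⟨F.obj ⋙ (evaluation K B).obj k, (isSheaf_functor_iff J _).1 F.property k⟩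
      map {k l} f := ⟨Functor.whiskerLeft F.obj ((evaluation K B).map f)⟩
      map_id k := by ext; simp
      map_comp f g := by ext; simp }, ⟨(fullyFaithfulSheafToPresheaf J _).preimageIso
        (Iso.refl F.obj)⟩⟩⟩
  have : G.IsEquivalence := { }
  let e : (Cᵒᵖ ⥤ K ⥤ B) ≌ (K ⥤ Cᵒᵖ ⥤ B) := Functor.flipping
  have : PreservesFiniteLimits ((Functor.whiskeringRight K _ _).obj (presheafToSheaf J B)) :=
    ⟨fun _ _ _ => inferInstance⟩
  have : PreservesFiniteLimits
      (e.functor ⋙ (Functor.whiskeringRight K _ _).obj (presheafToSheaf J B)) :=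
    comp_preservesFiniteLimits _ _
  exact hasSheafify_of_adjunction J
    (e.functor ⋙ (Functor.whiskeringRight K _ _).obj (presheafToSheaf J B)) G
    (e.toAdjunction.comp ((sheafificationAdjunction J B).whiskerRight K))

lemma grothendieck_functor (K : Type) [SmallCategory K] (B : Type v) [Category.{u} B]
    [Abelian B] [IsGrothendieckAbelian.{u} B] : IsGrothendieckAbelian.{u} (K ⥤ B) := by
  have : HasColimitsOfSize.{0, 0} B := hasColimitsOfSizeShrink.{0, 0, u, u} B
  have : HasCoproducts.{0} B := inferInstance
  have : AB5OfSize.{u, u} (Kᵒᵖᵒᵖ ⥤ B) := ⟨fun S _ _ => by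
    have : HasExactColimitsOfShape S B := AB5OfSize.ofShape S
    infer_instance⟩
  have : IsGrothendieckAbelian.{u} (Kᵒᵖᵒᵖ ⥤ B) := { }
  exact IsGrothendieckAbelian.of_equivalence (opOpEquivalence K).congrLeft

end Sheafification

/-! ### Categories of graded modules -/

section Graded

variable (R : Type u) [CommRing R]

/-- The category of `ℕ`-graded `R`-modules: an object is a family `(Mₙ)` of `R`-modules (the
homogeneous components), a morphism is a family of `R`-linear maps `Mₙ ⟶ Nₙ`. -/
abbrev GrMod : Type (u + 1) := GradedObject ℕ (ModuleCat.{u} R)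

instance gradedPreadditive : Preadditive (GrMod R) where
  homGroup M N := inferInstanceAs (AddCommGroup (∀ n, M n ⟶ N n))
  add_comp _ _ _ f f' g := by
    funext n
    exact Preadditive.add_comp _ _ _ (f n) (f' n) (g n)
  comp_add _ _ _ f g g' := by
    funext n
    exact Preadditive.comp_add _ _ _ (f n) (g n) (g' n)

def gradedEquivalence : GrMod R ≌ (Discrete ℕ ⥤ ModuleCat.{u} R) :=
  piEquivalenceFunctorDiscrete ℕ _

instance : Abelian (GrMod R) :=
  have : HasFiniteProducts (GrMod R) := ⟨fun _ =>
    Adjunction.hasLimitsOfShape_of_equivalence (gradedEquivalence R).functor⟩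
  abelianOfEquivalence (gradedEquivalence R).functor

instance : IsGrothendieckAbelian.{u} (GrMod R) :=
  have := grothendieck_functor (Discrete ℕ) (ModuleCat.{u} R)
  .of_equivalence (gradedEquivalence R).symm

instance (X : TopCat.{u}) : HasSheafify (Opens.grothendieckTopology X) (GrMod R) :=
  have := hasSheafify_functor (Opens.grothendieckTopology X) (Discrete ℕ) (ModuleCat.{u} R)
  hasSheafify_of_equivalence _ (gradedEquivalence R)

/-- An `ℕ`-graded module over the polynomial ring `R[t]`, graded by degree: the `R`-modules of
homogeneous elements together with the multiplication by `t`, which raises degrees by one. -/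
structure PolyGrMod where
  component : ℕ → ModuleCat.{u} R
  t (n : ℕ) : component n ⟶ component (n + 1)

variable {R} in
/-- A degree-preserving `R[t]`-linear map. -/
@[ext]
structure PolyGrMod.Hom (M N : PolyGrMod R) where
  app (n : ℕ) : M.component n ⟶ N.component n
  comm (n : ℕ) : M.t n ≫ app (n + 1) = app n ≫ N.t n

instance : Category (PolyGrMod R) where
  Hom := PolyGrMod.Hom
  id M := { app n := 𝟙 _
            comm n := (Category.comp_id _).trans (Category.id_comp _).symm }
  comp f g := { app n := f.app n ≫ g.app n
                comm n := by rw [← Category.assoc, f.comm, Category.assoc, g.comm, Category.assoc] }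
  id_comp f := PolyGrMod.Hom.ext (funext fun _ => Category.id_comp _)
  comp_id f := PolyGrMod.Hom.ext (funext fun _ => Category.comp_id _)
  assoc f g h := PolyGrMod.Hom.ext (funext fun _ => Category.assoc _ _ _)

def polyFunctor : PolyGrMod R ⥤ (ℕ ⥤ ModuleCat.{u} R) where
  obj M := Functor.ofSequence M.t
  map {M N} f := NatTrans.ofSequence (F := Functor.ofSequence M.t) (G := Functor.ofSequence N.t)
    f.app (fun n => by
      rw [Functor.ofSequence_map_homOfLE_succ, Functor.ofSequence_map_homOfLE_succ]
      exact f.comm n)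
  map_id M := by ext n : 2; rfl
  map_comp f g := by ext n : 2; rfl

def polyFullyFaithful : (polyFunctor R).FullyFaithful where
  preimage {M N} g := ⟨fun n => g.app n, fun n => by
    have h := g.naturality (homOfLE (Nat.le_add_right n 1))
    dsimp only [polyFunctor] at h
    rwa [Functor.ofSequence_map_homOfLE_succ, Functor.ofSequence_map_homOfLE_succ] at h⟩
  map_preimage g := by ext n : 2; rfl
  preimage_map f := rfl

instance : (polyFunctor R).IsEquivalence where
  faithful := (polyFullyFaithful R).faithful
  full := (polyFullyFaithful R).full
  essSurj := ⟨fun F => by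
    let M : PolyGrMod R := ⟨F.obj, fun n => F.map (homOfLE (Nat.le_add_right n 1))⟩
    let τ : (polyFunctor R).obj M ⟶ F :=
      NatTrans.ofSequence (F := Functor.ofSequence M.t) (fun n => 𝟙 (F.obj n)) (fun n => by
        rw [Functor.ofSequence_map_homOfLE_succ]
        exact (Category.comp_id _).trans (Category.id_comp _).symm)
    have : ∀ n, IsIso (τ.app n) := fun n => inferInstanceAs (IsIso (𝟙 (F.obj n)))
    have : IsIso τ := NatIso.isIso_of_isIso_app τ
    exact ⟨M, ⟨asIso τ⟩⟩⟩

instance polyPreadditive : Preadditive (PolyGrMod R) :=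
  .ofFullyFaithful (polyFullyFaithful R)

instance : Abelian (PolyGrMod R) :=
  have : HasFiniteProducts (PolyGrMod R) := ⟨fun _ =>
    Adjunction.hasLimitsOfShape_of_equivalence (polyFunctor R)⟩
  abelianOfEquivalence (polyFunctor R)

instance : IsGrothendieckAbelian.{u} (PolyGrMod R) :=
  have := grothendieck_functor ℕ (ModuleCat.{u} R)
  .of_equivalence (polyFunctor R).asEquivalence.symm

instance (X : TopCat.{u}) : HasSheafify (Opens.grothendieckTopology X) (PolyGrMod R) :=
  have := hasSheafify_functor (Opens.grothendieckTopology X) ℕ (ModuleCat.{u} R)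
  hasSheafify_of_equivalence _ (polyFunctor R).asEquivalence

end Graded

/-! ### Sheaf cohomology and inverse images

The definitions below are made for a Grothendieck abelian category `A` of coefficients for which
the (exact) sheafification exists. The instances needed for `R`-modules are in Mathlib, those for
the two categories of graded modules are above. -/

lemma lan_preservesFiniteLimits {C D : Type u} [SmallCategory C] [SmallCategory D]
    (E : Type v) [Category.{u} E] [Abelian E] [IsGrothendieckAbelian.{u} E]
    (F : C ⥤ D) [RepresentablyFlat F] :
    PreservesFiniteLimits (F.op.lan : (Cᵒᵖ ⥤ E) ⥤ (Dᵒᵖ ⥤ E)) := by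
  apply preservesFiniteLimits_of_preservesFiniteLimitsOfSize.{0}
  intro J _ _
  apply preservesLimitsOfShape_of_evaluation (F.op.lan : (Cᵒᵖ ⥤ E) ⥤ Dᵒᵖ ⥤ E) J
  intro K
  have : IsFiltered (CostructuredArrow F.op K) :=
    IsFiltered.of_equivalence (structuredArrowOpEquivalence F (unop K))
  have : HasExactColimitsOfShape (CostructuredArrow F.op K) E := AB5OfSize.ofShape _
  have : PreservesLimitsOfShape J (colim (J := CostructuredArrow F.op K) (C := E)) :=
    HasExactColimitsOfShape.preservesFiniteLimits.preservesFiniteLimits J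
  exact preservesLimitsOfShape_of_natIso (lanEvaluationIsoColim _ _ _).symm

section Cohomology

variable (A : Type v) [Category.{u} A] [Abelian A] [IsGrothendieckAbelian.{u} A]
  [∀ X : TopCat.{u}, HasSheafify (Opens.grothendieckTopology X) A]

/-- The global section functor `Γ(X, -)`. -/
def globalSections (X : TopCat.{u}) : TopCat.Sheaf A X ⥤ A :=
  TopCat.Sheaf.forget A X ⋙ (evaluation _ _).obj (op ⊤)

instance (X : TopCat.{u}) : (globalSections A X).Additive where

/-- The sheaf cohomology functor `H^k(X, -)`. -/
def cohomology (X : TopCat.{u}) (k : ℕ) : TopCat.Sheaf A X ⥤ A :=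
  (globalSections A X).rightDerived k

variable {X Y : TopCat.{u}} (f : X ⟶ Y)

/-- The inverse image functor `f^*`: the sheafification of the presheaf
`U ↦ colim_{f(U) ⊆ V} F(V)`. -/
def inverseImage : TopCat.Sheaf A Y ⥤ TopCat.Sheaf A X :=
  TopCat.Sheaf.forget A Y ⋙ TopCat.Presheaf.pullback A f ⋙
    presheafToSheaf (Opens.grothendieckTopology X) A

/-- The adjunction `f^* ⊣ f_*`. -/
def inverseImageAdj : inverseImage A f ⊣ TopCat.Sheaf.pushforward A f :=
  Functor.sheafPullbackConstruction.sheafAdjunctionContinuous (Opens.map f) A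
    (Opens.grothendieckTopology Y) (Opens.grothendieckTopology X)

instance : (inverseImage A f).IsLeftAdjoint := (inverseImageAdj A f).isLeftAdjoint

instance : PreservesFiniteLimits (inverseImage A f) := by
  have := lan_preservesFiniteLimits A (Opens.map f)
  exact inferInstanceAs (PreservesFiniteLimits
    (Functor.sheafPullbackConstruction.sheafPullback (Opens.map f) A
    (Opens.grothendieckTopology Y) (Opens.grothendieckTopology X)))

instance : PreservesFiniteColimits (inverseImage A f) := inferInstance

instance : (inverseImage A f).Additive := Functor.additive_of_preserves_binary_products _

instance : (inverseImage A f).PreservesHomology := inferInstance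

/-- The first map `Z ⟶ I⁰` of an injective resolution `0 → Z → I⁰ → I¹ → ⋯`. -/
def augmentation {C : Type*} [Category* C] [Abelian C] {Z : C} (I : InjectiveResolution Z) :
    Z ⟶ I.cocomplex.X 0 :=
  I.ι.f 0

lemma augmentation_comp_d {C : Type*} [Category* C] [Abelian C] {Z : C}
    (I : InjectiveResolution Z) : augmentation I ≫ I.cocomplex.d 0 1 = 0 :=
  I.ι_f_zero_comp_complex_d

instance {C : Type*} [Category* C] [Abelian C] {Z : C} (I : InjectiveResolution Z) :
    Mono (augmentation I) :=
  inferInstanceAs (Mono (I.ι.f 0))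

/-- A morphism lifts to a morphism from any resolution to an injective resolution. -/
lemma exists_lift {C : Type*} [Category* C] [Abelian C] {Z Z' : C} (φ : Z ⟶ Z')
    (L : CochainComplex C ℕ) (l : Z ⟶ L.X 0) [Mono l] (w : l ≫ L.d 0 1 = 0)
    (h₀ : (ShortComplex.mk l (L.d 0 1) w).Exact)
    (h : ∀ n, (ShortComplex.mk _ _ (L.d_comp_d n (n + 1) (n + 2))).Exact)
    (J : InjectiveResolution Z') :
    ∃ g : L ⟶ J.cocomplex, l ≫ g.f 0 = φ ≫ augmentation J := by
  let g₀ : L.X 0 ⟶ J.cocomplex.X 0 := Injective.factorThru (φ ≫ augmentation J) l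
  have e₀ : l ≫ g₀ = φ ≫ augmentation J := Injective.comp_factorThru _ _
  have e₁ : l ≫ g₀ ≫ J.cocomplex.d 0 1 = 0 := by
    rw [reassoc_of% e₀, augmentation_comp_d, comp_zero]
  let g₁ : L.X 1 ⟶ J.cocomplex.X 1 := h₀.descToInjective (g₀ ≫ J.cocomplex.d 0 1) e₁
  have e₂ : L.d 0 1 ≫ g₁ = g₀ ≫ J.cocomplex.d 0 1 := h₀.comp_descToInjective _ _
  refine ⟨CochainComplex.mkHom _ _ g₀ g₁ e₂.symm fun n ⟨a, b, c⟩ =>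
    ⟨(h n).descToInjective (b ≫ J.cocomplex.d (n + 1) (n + 2)) ?_, ?_⟩, ?_⟩
  · dsimp
    rw [← reassoc_of% c, J.cocomplex.d_comp_d, comp_zero]
  · exact ((h n).comp_descToInjective _ _).symm
  · simpa using e₀

variable {A}

/-- The choices in the construction of the map induced by `f` in cohomology: injective resolutions
`I` of `F` and `J` of `f^* F`, and a cochain map `g : f^* I ⟶ J` lifting the identity
of `f^* F`. -/
structure LiftData (F : TopCat.Sheaf A Y) where
  I : InjectiveResolution F
  J : InjectiveResolution ((inverseImage A f).obj F)
  g : ((inverseImage A f).mapHomologicalComplex _).obj I.cocomplex ⟶ J.cocomplex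
  comm : (inverseImage A f).map (augmentation I) ≫ g.f 0 = augmentation J

/-- Such choices exist, because `f^*` is exact and there are enough injective sheaves. -/
instance (F : TopCat.Sheaf A Y) : Nonempty (LiftData f F) := by
  let I : InjectiveResolution F := injectiveResolution F
  let J : InjectiveResolution ((inverseImage A f).obj F) := injectiveResolution _
  let L : CochainComplex (TopCat.Sheaf A X) ℕ :=
    ((inverseImage A f).mapHomologicalComplex _).obj I.cocomplex
  let l : (inverseImage A f).obj F ⟶ L.X 0 := (inverseImage A f).map (augmentation I)
  have : Mono l := inferInstanceAs (Mono ((inverseImage A f).map (augmentation I)))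
  have w : (inverseImage A f).map (augmentation I) ≫
      (inverseImage A f).map (I.cocomplex.d 0 1) = 0 := by
    rw [← Functor.map_comp, augmentation_comp_d, Functor.map_zero]
  obtain ⟨g, hg⟩ := exists_lift (𝟙 ((inverseImage A f).obj F)) L l w
    (I.exact₀.map (inverseImage A f))
    (fun n => (I.exact_succ n).map (inverseImage A f)) J
  exact ⟨⟨I, J, g, hg.trans (Category.id_comp _)⟩⟩

/-- The identification `Γ(Y, f_* G) = Γ(X, G)`. -/
def sectionsPushforward :
    TopCat.Sheaf.pushforward A f ⋙ globalSections A Y ≅ globalSections A X :=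
  Iso.refl _

/-- The natural map `Γ(Y, F) ⟶ Γ(Y, f_* f^* F) = Γ(X, f^* F)` given by the unit of `f^* ⊣ f_*`. -/
def sectionsUnit : globalSections A Y ⟶ inverseImage A f ⋙ globalSections A X where
  app F := (globalSections A Y).map ((inverseImageAdj A f).unit.app F) ≫
    (sectionsPushforward f).hom.app ((inverseImage A f).obj F)
  naturality F G φ := by
    have h1 := (inverseImageAdj A f).unit.naturality φ
    have h2 := (sectionsPushforward f).hom.naturality ((inverseImage A f).map φ)
    simp only [Functor.id_map, Functor.comp_map, Functor.comp_obj, Functor.id_obj] at h1 h2 ⊢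
    rw [Category.assoc, ← h2, ← Functor.map_comp_assoc, ← Functor.map_comp_assoc, h1]

/-- The map `H^k(f, F) : H^k(Y, F) ⟶ H^k(X, f^* F)` constructed with the choices `D`, namely
`H^k(Γ(Y, I)) ⟶ H^k(Γ(X, f^* I)) ⟶ H^k(Γ(X, J))`, where the isomorphisms at both ends compute
the right derived functors by the resolutions `I` and `J`. -/
def cohomologyMap {F : TopCat.Sheaf A Y} (D : LiftData f F) (k : ℕ) :
    (cohomology A Y k).obj F ⟶ (cohomology A X k).obj ((inverseImage A f).obj F) :=
  (D.I.isoRightDerivedObj (globalSections A Y) k).hom ≫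
    HomologicalComplex.homologyMap
      ((NatTrans.mapHomologicalComplex (sectionsUnit f) (ComplexShape.up ℕ)).app D.I.cocomplex) k ≫
    HomologicalComplex.homologyMap
      (((globalSections A X).mapHomologicalComplex _).map D.g) k ≫
    (D.J.isoRightDerivedObj (globalSections A X) k).inv

/-- The map `H^k(f, F)`, for some choice of resolutions and lifts. -/
def inducedMap (F : TopCat.Sheaf A Y) (k : ℕ) :
    (cohomology A Y k).obj F ⟶ (cohomology A X k).obj ((inverseImage A f).obj F) :=
  cohomologyMap f (Classical.arbitrary (LiftData f F)) k

end Cohomology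

/-! ### Diagrams of spaces and sheaves -/

section Modules

variable {A : Type v} [Category.{u} A] [Abelian A] [IsGrothendieckAbelian.{u} A]
  [∀ X : TopCat.{u}, HasSheafify (Opens.grothendieckTopology X) A]

/-- The canonical isomorphism `f^* g^* ≅ h^*` for `h = g ∘ f`, which corresponds under the
adjunctions to the equality `g_* f_* = h_*`. -/
def inverseImageComp {X Y Z : TopCat.{u}} (f : X ⟶ Y) (g : Y ⟶ Z) (h : X ⟶ Z) (w : f ≫ g = h) :
    inverseImage A g ⋙ inverseImage A f ≅ inverseImage A h :=
  ((inverseImageAdj A g).comp (inverseImageAdj A f)).leftAdjointUniq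
    ((inverseImageAdj A h).ofNatIsoRight (eqToIso (by subst w; rfl)))

/-- The map `X_i ⟶ X_∞` of a diagram of spaces `X_0 ⟶ X_1 ⟶ ⋯ ⟶ X_∞`. -/
abbrev toInfty (X : WithTop ℕ ⥤ TopCat.{u}) (i : ℕ) : X.obj (i : WithTop ℕ) ⟶ X.obj ⊤ :=
  X.map (homOfLE le_top)

/-- The map `X_i ⟶ X_{i+1}` of a diagram of spaces `X_0 ⟶ X_1 ⟶ ⋯ ⟶ X_∞`. -/
abbrev toSucc (X : WithTop ℕ ⥤ TopCat.{u}) (i : ℕ) :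
    X.obj (i : WithTop ℕ) ⟶ X.obj ((i + 1 : ℕ) : WithTop ℕ) :=
  X.map (homOfLE (WithTop.coe_le_coe.2 (Nat.le_succ i)))

lemma toSucc_toInfty (X : WithTop ℕ ⥤ TopCat.{u}) (i : ℕ) :
    toSucc X i ≫ toInfty X (i + 1) = toInfty X i := by
  rw [← X.map_comp]; rfl

/-- The type A module over `X_i`: the persistence module
`H^k(X_i, F^i_0) ⟶ H^k(X_i, F^i_1) ⟶ ⋯`, where `F^i_j` is the inverse image of `F_j` on `X_i`. -/
def typeA (X : WithTop ℕ ⥤ TopCat.{u}) (F : ℕ ⥤ TopCat.Sheaf A (X.obj ⊤)) (k i : ℕ) : ℕ ⥤ A :=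
  F ⋙ inverseImage A (toInfty X i) ⋙ cohomology A (X.obj (i : WithTop ℕ)) k

/-- The type T module of a sheaf `F` on `X_∞`: the copersistence module
`H^k(X_0, F^0) ⟵ H^k(X_1, F^1) ⟵ ⋯`, where `F^i` is the inverse image of `F` on `X_i`. Its maps
are induced by `X_i ⟶ X_{i+1}`, the inverse image of `F^{i+1}` on `X_i` being identified
with `F^i`. -/
def typeT (X : WithTop ℕ ⥤ TopCat.{u}) (F : TopCat.Sheaf A (X.obj ⊤)) (k : ℕ) : ℕᵒᵖ ⥤ A :=
  Functor.ofOpSequence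
    (X := fun i : ℕ => (cohomology A (X.obj (i : WithTop ℕ)) k).obj
      ((inverseImage A (toInfty X i)).obj F))
    (fun i => inducedMap (toSucc X i) ((inverseImage A (toInfty X (i + 1))).obj F) k ≫
      (cohomology A (X.obj (i : WithTop ℕ)) k).map
        ((inverseImageComp _ _ _ (toSucc_toInfty X i)).hom.app F))

/-- The rows `typeA X F k i` and the columns `typeT X (F.obj j) k` form a commutative
two-dimensional diagram, that is, they are the rows and the columns of a functor
on `ℕ × ℕᵒᵖ`. -/
def CombinedModuleCommutes (X : WithTop ℕ ⥤ TopCat.{u}) (F : ℕ ⥤ TopCat.Sheaf A (X.obj ⊤))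
    (k : ℕ) : Prop :=
  ∃ M : ℕ × ℕᵒᵖ ⥤ A,
    (∀ i : ℕ, Prod.sectL ℕ (op i) ⋙ M = typeA X F k i) ∧
    (∀ j : ℕ, Prod.sectR j ℕᵒᵖ ⋙ M = typeT X (F.obj j) k)

end Modules

end

end SheafCoh

open SheafCoh

namespace SheafCoh

noncomputable section

/-! Naturality is the comparison theorem for injective resolutions. Lift `φ` to `a : D.I ⟶ E.I` and
`f^*φ` to `b : D.J ⟶ E.J`. Since `f^*` is exact, `f^* D.I` still resolves `f^* F`, so the two maps
`f^* D.I ⟶ E.J`, namely `f^* a` followed by `E.g` and `D.g` followed by `b`, both lift `f^*φ` and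
are homotopic (`nonempty_homotopy`). An additive functor preserves homotopies, so the square formed
with `Γ(X, -)` commutes in homology although `Γ(X, -)` is not exact. No choice of resolutions or
lifts matters.

For the diagram, naturality in the sheaf makes each `F_j ⟶ F_{j+1}` a morphism of columns
(`typeTMap`). The columns then form a functor `ℕ ⥤ ℕᵒᵖ ⥤ A`, and uncurrying it gives the
two-dimensional diagram. -/

/-- A cochain map from an exact complex `0 → Z → L⁰ → L¹ → ⋯` to an injective resolution which
vanishes on `Z` is null-homotopic. -/
lemma nonempty_homotopy_zero {C : Type*} [Category* C] [Abelian C] {Z Z' : C}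
    (L : CochainComplex C ℕ) (l : Z ⟶ L.X 0) (w : l ≫ L.d 0 1 = 0)
    (h₀ : (ShortComplex.mk l (L.d 0 1) w).Exact)
    (h : ∀ n, (ShortComplex.mk _ _ (L.d_comp_d n (n + 1) (n + 2))).Exact)
    (J : InjectiveResolution Z') (g : L ⟶ J.cocomplex) (hg : l ≫ g.f 0 = 0) :
    Nonempty (Homotopy g 0) := by
  let s₀ : L.X 1 ⟶ J.cocomplex.X 0 := h₀.descToInjective (g.f 0) hg
  have e₀ : L.d 0 1 ≫ s₀ = g.f 0 := h₀.comp_descToInjective _ _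
  -- The error left by `s₀` in degree 1 kills the image of `L.d 0 1`, so by exactness it factors
  -- through the image of `L.d 1 2` and extends by injectivity.
  have w₁ : L.d 0 1 ≫ (g.f 1 - s₀ ≫ J.cocomplex.d 0 1) = 0 := by
    rw [Preadditive.comp_sub, reassoc_of% e₀, HomologicalComplex.Hom.comm, sub_self]
  let s₁ : L.X 2 ⟶ J.cocomplex.X 1 := (h 0).descToInjective (g.f 1 - s₀ ≫ J.cocomplex.d 0 1) w₁
  have e₁ : L.d 1 2 ≫ s₁ = g.f 1 - s₀ ≫ J.cocomplex.d 0 1 := (h 0).comp_descToInjective _ _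
  -- Here `a`, `b` are consecutive components of the homotopy and `c` is the homotopy identity in
  -- degree `n + 1`. The next component comes from exactness at `L.X (n + 2)`, which is `h (n + 1)`:
  -- by `c` and `d ≫ d = 0`, the error `g - b ≫ d` vanishes after `L.d`.
  refine ⟨Homotopy.mkCoinductive g s₀ e₀.symm s₁ (by rw [e₁, add_sub_cancel])
    fun n ⟨a, b, c⟩ =>
      ⟨(h (n + 1)).descToInjective (g.f (n + 2) - b ≫ J.cocomplex.d (n + 1) (n + 2)) ?_, ?_⟩⟩
  · dsimp
    rw [Preadditive.comp_sub, ← HomologicalComplex.Hom.comm, c, Preadditive.add_comp,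
      Category.assoc, Category.assoc, HomologicalComplex.d_comp_d, comp_zero, zero_add, sub_self]
  · have e := (h (n + 1)).comp_descToInjective (g.f (n + 2) - b ≫ J.cocomplex.d (n + 1) (n + 2)) (by
      dsimp
      rw [Preadditive.comp_sub, ← HomologicalComplex.Hom.comm, c, Preadditive.add_comp,
        Category.assoc, Category.assoc, HomologicalComplex.d_comp_d, comp_zero, zero_add, sub_self])
    dsimp at e
    rw [e, add_sub_cancel]

/-- Two lifts of the same morphism to an injective resolution are homotopic. -/
lemma nonempty_homotopy {C : Type*} [Category* C] [Abelian C] {Z Z' : C}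
    (L : CochainComplex C ℕ) (l : Z ⟶ L.X 0) (w : l ≫ L.d 0 1 = 0)
    (h₀ : (ShortComplex.mk l (L.d 0 1) w).Exact)
    (h : ∀ n, (ShortComplex.mk _ _ (L.d_comp_d n (n + 1) (n + 2))).Exact)
    (J : InjectiveResolution Z') (g g' : L ⟶ J.cocomplex) (hg : l ≫ g.f 0 = l ≫ g'.f 0) :
    Nonempty (Homotopy g g') := by
  obtain ⟨s⟩ := nonempty_homotopy_zero L l w h₀ h J (g - g') (by
    rw [HomologicalComplex.sub_f_apply, Preadditive.comp_sub, hg, sub_self])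
  exact ⟨Homotopy.equivSubZero.symm s⟩

/-! ### Naturality of the induced map in cohomology -/

section Naturality

variable {A : Type v} [Category.{u} A] [Abelian A] [IsGrothendieckAbelian.{u} A]
  [∀ X : TopCat.{u}, HasSheafify (Opens.grothendieckTopology X) A]
  {X Y : TopCat.{u}} (f : X ⟶ Y)

/-- The map `H^k(f, F)` is natural in `F`, whatever resolutions and lifts are chosen. -/
theorem cohomologyMap_naturality {F G : TopCat.Sheaf A Y} (φ : F ⟶ G)
    (D : LiftData f F) (E : LiftData f G) (k : ℕ) :
    (cohomology A Y k).map φ ≫ cohomologyMap f E k =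
      cohomologyMap f D k ≫ (cohomology A X k).map ((inverseImage A f).map φ) := by
  let a : D.I.cocomplex ⟶ E.I.cocomplex := InjectiveResolution.desc φ E.I D.I
  have ha : augmentation D.I ≫ a.f 0 = φ ≫ augmentation E.I :=
    InjectiveResolution.desc_commutes_zero φ E.I D.I
  let b : D.J.cocomplex ⟶ E.J.cocomplex :=
    InjectiveResolution.desc ((inverseImage A f).map φ) E.J D.J
  have hb : augmentation D.J ≫ b.f 0 = (inverseImage A f).map φ ≫ augmentation E.J :=
    InjectiveResolution.desc_commutes_zero _ E.J D.J
  have w : (inverseImage A f).map (augmentation D.I) ≫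
      (inverseImage A f).map (D.I.cocomplex.d 0 1) = 0 := by
    rw [← Functor.map_comp, augmentation_comp_d, Functor.map_zero]
  obtain ⟨s⟩ := nonempty_homotopy
    (((inverseImage A f).mapHomologicalComplex (ComplexShape.up ℕ)).obj D.I.cocomplex)
    ((inverseImage A f).map (augmentation D.I)) w (D.I.exact₀.map (inverseImage A f))
    (fun n => (D.I.exact_succ n).map (inverseImage A f)) E.J
    -- On `f^* F` both composites equal `f^*φ` followed by the augmentation of `E.J`, by `ha` with
    -- `E.comm` on one side and `D.comm` with `hb` on the other.
    (((inverseImage A f).mapHomologicalComplex _).map a ≫ E.g) (D.g ≫ b) (by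
      have e : (inverseImage A f).map (augmentation D.I) ≫ (inverseImage A f).map (a.f 0) =
          (inverseImage A f).map φ ≫ (inverseImage A f).map (augmentation E.I) := by
        rw [← Functor.map_comp, ha, Functor.map_comp]
      have e' := (reassoc_of% e) (E.g.f 0)
      have e'' := D.comm =≫ b.f 0
      exact e'.trans ((((inverseImage A f).map φ ≫= E.comm).trans hb.symm).trans
        (e''.symm.trans (Category.assoc _ _ _))))
  have hs := ((globalSections A X).mapHomotopy s).homologyMap_eq k
  rw [Functor.map_comp, Functor.map_comp, HomologicalComplex.homologyMap_comp,
    HomologicalComplex.homologyMap_comp] at hs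
  have hη := congrArg (fun t => HomologicalComplex.homologyMap t k)
    ((NatTrans.mapHomologicalComplex (sectionsUnit f) (ComplexShape.up ℕ)).naturality a)
  rw [HomologicalComplex.homologyMap_comp, HomologicalComplex.homologyMap_comp] at hη
  have hI := InjectiveResolution.isoRightDerivedObj_hom_naturality φ D.I E.I a ha
    (globalSections A Y) k
  have hJ := InjectiveResolution.isoRightDerivedObj_inv_naturality _ D.J E.J b hb
    (globalSections A X) k
  -- One square for each of the four factors of `cohomologyMap`; only `hs` needs the passage to
  -- homology in order to commute.
  exact (CommSq.vert_comp ⟨hI⟩ (CommSq.vert_comp ⟨hη⟩ (CommSq.vert_comp ⟨hs⟩ ⟨hJ.symm⟩))).w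

lemma inducedMap_naturality {F G : TopCat.Sheaf A Y} (φ : F ⟶ G) (k : ℕ) :
    (cohomology A Y k).map φ ≫ inducedMap f G k =
      inducedMap f F k ≫ (cohomology A X k).map ((inverseImage A f).map φ) :=
  cohomologyMap_naturality f φ _ _ k

end Naturality

/-! ### Assembling rows and columns into one functor -/

section Diagrams

variable {A : Type v} [Category.{u} A] [Abelian A] [IsGrothendieckAbelian.{u} A]
  [∀ X : TopCat.{u}, HasSheafify (Opens.grothendieckTopology X) A]

lemma typeT_map_succ (X : WithTop ℕ ⥤ TopCat.{u}) (F : TopCat.Sheaf A (X.obj ⊤)) (k i : ℕ) :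
    (typeT X F k).map (homOfLE (Nat.le_add_right i 1)).op =
      inducedMap (toSucc X i) ((inverseImage A (toInfty X (i + 1))).obj F) k ≫
        (cohomology A (X.obj (i : WithTop ℕ)) k).map
          ((inverseImageComp _ _ _ (toSucc_toInfty X i)).hom.app F) :=
  Functor.ofOpSequence_map_homOfLE_succ _ i

/-- A morphism of sheaves on `X_∞` induces a morphism of type T modules. -/
def typeTMap (X : WithTop ℕ ⥤ TopCat.{u}) {F G : TopCat.Sheaf A (X.obj ⊤)} (φ : F ⟶ G) (k : ℕ) :
    typeT X F k ⟶ typeT X G k :=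
  NatTrans.ofOpSequence (F := typeT X F k) (G := typeT X G k)
    (fun i => (cohomology A (X.obj (i : WithTop ℕ)) k).map
      ((inverseImage A (toInfty X i)).map φ))
    (fun i => by
      -- A column map is an induced map followed by the canonical identification of inverse images,
      -- so its square splits into two: `e₂` for the former, `e₁` for the latter.
      have h := (inverseImageComp (A := A) _ _ _ (toSucc_toInfty X i)).hom.naturality φ
      have e₁ := congrArg (cohomology A (X.obj (i : WithTop ℕ)) k).map h
      rw [Functor.map_comp, Functor.map_comp] at e₁
      have e₂ := (reassoc_of% (inducedMap_naturality (toSucc X i)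
        ((inverseImage A (toInfty X (i + 1))).map φ) k))
        ((cohomology A (X.obj (i : WithTop ℕ)) k).map
          ((inverseImageComp _ _ _ (toSucc_toInfty X i)).hom.app G))
      rw [typeT_map_succ, typeT_map_succ]
      exact ((Category.assoc _ _ _).trans (_ ≫= e₁.symm)).trans e₂.symm)

/-- The type T module as a functor of the sheaf on `X_∞`. -/
def typeTFunctor (X : WithTop ℕ ⥤ TopCat.{u}) (k : ℕ) :
    TopCat.Sheaf A (X.obj ⊤) ⥤ ℕᵒᵖ ⥤ A where
  obj F := typeT X F k
  map φ := typeTMap X φ k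
  map_id F := by
    ext i
    exact ((inverseImage A (toInfty X i.unop)) ⋙ cohomology A _ k).map_id F
  map_comp φ ψ := by
    ext i
    exact ((inverseImage A (toInfty X i.unop)) ⋙ cohomology A _ k).map_comp φ ψ

/-- On objects, the restrictions of the uncurried functor agree definitionally with the prescribed
rows and columns. On morphisms, one of the two factors of each map is the image of an identity. -/
theorem combinedModuleCommutes (X : WithTop ℕ ⥤ TopCat.{u})
    (F : ℕ ⥤ TopCat.Sheaf A (X.obj ⊤)) (k : ℕ) : CombinedModuleCommutes X F k := by
  refine ⟨Functor.uncurry.obj (F ⋙ typeTFunctor X k), fun i => ?_, fun j => ?_⟩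
  · refine Functor.hext (fun _ => rfl) fun j j' g => heq_of_eq ?_
    change ((typeTFunctor X k).map (F.map g)).app (op i) ≫
      ((typeTFunctor X k).obj (F.obj j')).map (𝟙 (op i)) = _
    rw [CategoryTheory.Functor.map_id]
    exact Category.comp_id _
  · refine Functor.hext (fun _ => rfl) fun i i' g => heq_of_eq ?_
    change ((typeTFunctor X k).map (F.map (𝟙 j))).app i ≫ (typeT X (F.obj j) k).map g = _
    rw [CategoryTheory.Functor.map_id, CategoryTheory.Functor.map_id]
    exact Category.id_comp _

end Diagrams

end

end SheafCoh

theorem theorem511 (R : Type u) [CommRing R] :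
    -- sheaves of `R`-modules
    ((∀ (X Y : TopCat.{u}) (f : X ⟶ Y) (F G : TopCat.Sheaf (ModuleCat.{u} R) Y) (φ : F ⟶ G)
        (D : LiftData f F) (E : LiftData f G) (k : ℕ),
        (cohomology (ModuleCat.{u} R) Y k).map φ ≫ cohomologyMap f E k =
          cohomologyMap f D k ≫
            (cohomology (ModuleCat.{u} R) X k).map ((inverseImage (ModuleCat.{u} R) f).map φ)) ∧
      (∀ (X : WithTop ℕ ⥤ TopCat.{u}) (F : ℕ ⥤ TopCat.Sheaf (ModuleCat.{u} R) (X.obj ⊤)) (k : ℕ),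
        CombinedModuleCommutes X F k)) ∧
    -- sheaves of graded `R`-modules
    ((∀ (X Y : TopCat.{u}) (f : X ⟶ Y) (F G : TopCat.Sheaf (GrMod R) Y) (φ : F ⟶ G)
        (D : LiftData f F) (E : LiftData f G) (k : ℕ),
        (cohomology (GrMod R) Y k).map φ ≫ cohomologyMap f E k =
          cohomologyMap f D k ≫
            (cohomology (GrMod R) X k).map ((inverseImage (GrMod R) f).map φ)) ∧
      (∀ (X : WithTop ℕ ⥤ TopCat.{u}) (F : ℕ ⥤ TopCat.Sheaf (GrMod R) (X.obj ⊤)) (k : ℕ),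
        CombinedModuleCommutes X F k)) ∧
    -- sheaves of graded modules over the graded ring `R[t]`
    ((∀ (X Y : TopCat.{u}) (f : X ⟶ Y) (F G : TopCat.Sheaf (PolyGrMod R) Y) (φ : F ⟶ G)
        (D : LiftData f F) (E : LiftData f G) (k : ℕ),
        (cohomology (PolyGrMod R) Y k).map φ ≫ cohomologyMap f E k =
          cohomologyMap f D k ≫
            (cohomology (PolyGrMod R) X k).map ((inverseImage (PolyGrMod R) f).map φ)) ∧
      (∀ (X : WithTop ℕ ⥤ TopCat.{u}) (F : ℕ ⥤ TopCat.Sheaf (PolyGrMod R) (X.obj ⊤)) (k : ℕ),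
        CombinedModuleCommutes X F k)) :=
  ⟨⟨fun _ _ f _ _ φ D E k => cohomologyMap_naturality f φ D E k, combinedModuleCommutes⟩,
    ⟨fun _ _ f _ _ φ D E k => cohomologyMap_naturality f φ D E k, combinedModuleCommutes⟩,
    ⟨fun _ _ f _ _ φ D E k => cohomologyMap_naturality f φ D E k, combinedModuleCommutes⟩⟩
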